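/- **Theorem (Hoffman ratio-type bound for the quantum $k$-distance chromatic number).** Let $G=(V,E)$ be a finite simple graph on $n\ge 2$ vertices, with adjacency matrix $A$ having eigenvalues $\lambda_1\ge\cdots\ge\lambda_n$ (with multiplicity), and let $k$ be a positive integer. A *quantum $k$-distance $c$-coloring* of $G$ in dimension $d$ is a family of orthogonal projectors $P_{v,h}\in\mathbb{C}^{d\times d}$ ($v\in V$, $h\in\{1,\dots,c\}$; that is, $P_{v,h}^2=P_{v,h}=P_{v,h}^{*}$) such that $\sum_{h=1}^{c}P_{v,h}=I_d$ for every $v\in V$, and $P_{v,h}P_{w,h}=0$ for every $h$ and all distinct $v,w\in V$ with $\operatorname{dist}_G(v,w)\le k$ (vertices in different components have infinite distance). The *quantum $k$-distance chromatic number* $\chi_{kq}(G)$ is the smallest $c$ for which $G$ admits a quantum $k$-distance $c$-coloring in some dimension $d>0$. Let $p\in\mathbb{R}[x]$ be a polynomial of degree at most $k$ such that $p(\lambda_1)>p(\lambda_i)$ for all $i\in\{2,\dots,n\}$. Put $W(p):=\max_{u\in V}(p(A))_{uu}$ and $\lambda(p):=\min_{2\le i\le n}p(\lambda_i)$. Then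 $$\chi_{kq}(G)\;\ge\;\frac{p(\lambda_1)-\lambda(p)}{W(p)-\lambda(p)}.$$ -/

import Mathlib

/-- A quantum `k`-distance `c`-coloring of `G` in dimension `d`: a family of orthogonal projectors
`P v h` in `ℂ^{d × d}`. The extended distance is used, so vertices in different components
(at distance `⊤`) are not constrained. -/
structure IsQuantumDistColoring {V : Type*} (G : SimpleGraph V) (k c d : ℕ)
    (P : V → Fin c → Matrix (Fin d) (Fin d) ℂ) : Prop where
  /-- Each `P v h` is an orthogonal projector: idempotent and Hermitian. -/
  projector : ∀ v h, IsStarProjection (P v h)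
  /-- Completeness. -/
  complete : ∀ v, ∑ h, P v h = 1
  /-- Orthogonality for distinct vertices at distance at most `k`. -/
  orthogonal : ∀ v w, v ≠ w → G.edist v w ≤ (k : ℕ∞) → ∀ h, P v h * P w h = 0

/-- `G` admits a quantum `k`-distance `c`-coloring in some positive dimension. -/
def QuantumDistColorable {V : Type*} (G : SimpleGraph V) (k c : ℕ) : Prop :=
  ∃ d : ℕ, 0 < d ∧ ∃ P : V → Fin c → Matrix (Fin d) (Fin d) ℂ, IsQuantumDistColoring G k c d P

/-- On a finite vertex set there is always such a coloring, with one color per vertex, so the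
minimum in `quantumDistChromaticNumber` is attained. -/
theorem quantumDistColorable_card {V : Type*} [Fintype V] (G : SimpleGraph V) (k : ℕ) :
    QuantumDistColorable G k (Fintype.card V) := by
  classical
  let e := Fintype.equivFin V
  refine ⟨1, one_pos, fun v h => if e v = h then 1 else 0, ?_, ?_, ?_⟩
  · intro v h
    split_ifs
    · exact .one _
    · exact .zero _
  · intro v
    simp
  · intro v w hvw _ h
    split_ifs with h1 h2
    · exact absurd (e.injective (h1.trans h2.symm)) hvw
    all_goals simp

/-- The quantum `k`-distance chromatic number `χ_kq(G)`: the smallest `c` for which `G` admits a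
quantum `k`-distance `c`-coloring. -/
noncomputable def quantumDistChromaticNumber {V : Type*} [Fintype V] (G : SimpleGraph V)
    (k : ℕ) : ℕ :=
  sInf {c : ℕ | QuantumDistColorable G k c}

/-- The adjacency eigenvalues `λ₁ ≥ ⋯ ≥ λₙ` of `G` with multiplicity, in non-increasing order;
`λ_{i+1}` is the value at `i : Fin n`, where `n` is the number of vertices. -/
noncomputable def adjEigenvalue {V : Type*} [Fintype V] [DecidableEq V] (G : SimpleGraph V)
    [DecidableRel G.Adj] : Fin (Fintype.card V) → ℝ :=
  (G.isHermitian_adjMatrix ℝ).eigenvalues₀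

/-- `W(p)`: the maximum diagonal entry of `p(A)`. -/
noncomputable def maxDiag {V : Type*} [Fintype V] [DecidableEq V] (G : SimpleGraph V)
    [DecidableRel G.Adj] (p : Polynomial ℝ) : ℝ :=
  ⨆ u : V, (Polynomial.aeval (G.adjMatrix ℝ) p) u u

/-- `λ(p)`: the minimum of `p(λ_i)` over `2 ≤ i ≤ n`. -/
noncomputable def minEval {V : Type*} [Fintype V] [DecidableEq V] (G : SimpleGraph V)
    [DecidableRel G.Adj] (p : Polynomial ℝ) : ℝ :=
  ⨅ i : {i : Fin (Fintype.card V) // 1 ≤ (i : ℕ)}, p.eval (adjEigenvalue G i)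

/-!
Let `P v h` be a quantum coloring with `c` colors and `M` a positive semidefinite matrix whose
off-diagonal entries vanish outside the pairs at distance at most `k`. The all-ones column is the
sum over the colors `h` of the columns `(P v h)_v`. By Cauchy–Schwarz, `M ⊗ 1` at this sum is at
most `c` times the sum of its values at the `c` columns, and orthogonality leaves only the diagonal
of `M` in the latter. Hence the entries of `M` sum to at most `c * tr M`. Rescaling rows and columns
of `M` by a unit eigenvector gives `μ ≤ c * max_v M v v` for every eigenvalue `μ`, and the theorem
is the case `M = p(A) - λ(p)`, which has the required support because `deg p ≤ k`.
-/

open scoped Matrix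

section StarOrderedRing

variable {ι A : Type*} [NonUnitalRing A] [StarRing A] [PartialOrder A] [StarOrderedRing A]

theorem star_sum_mul_sum_le_card_nsmul (s : Finset ι) (a : ι → A) :
    star (∑ i ∈ s, a i) * ∑ i ∈ s, a i ≤ s.card • ∑ i ∈ s, star (a i) * a i := by
  classical
  induction s using Finset.induction_on with
  | empty => simp
  | insert j s hj ih =>
    have hcross : star (a j) * ∑ i ∈ s, a i + star (∑ i ∈ s, a i) * a j ≤
        s.card • (star (a j) * a j) + ∑ i ∈ s, star (a i) * a i := by
      rw [← sub_nonneg]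
      calc 0 ≤ ∑ i ∈ s, star (a j - a i) * (a j - a i) :=
            Finset.sum_nonneg fun i _ => star_mul_self_nonneg _
        _ = _ := by
            simp only [star_sub, sub_mul, mul_sub, Finset.sum_sub_distrib, Finset.sum_const,
              ← Finset.mul_sum, ← Finset.sum_mul, ← star_sum]
            abel
    rw [Finset.sum_insert hj, Finset.sum_insert hj, Finset.card_insert_of_notMem hj]
    calc star (a j + ∑ i ∈ s, a i) * (a j + ∑ i ∈ s, a i)
        = star (a j) * a j + (star (a j) * ∑ i ∈ s, a i + star (∑ i ∈ s, a i) * a j) +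
            star (∑ i ∈ s, a i) * ∑ i ∈ s, a i := by
          rw [star_add, add_mul, mul_add, mul_add]
          abel
      _ ≤ star (a j) * a j + (s.card • (star (a j) * a j) + ∑ i ∈ s, star (a i) * a i) +
            s.card • ∑ i ∈ s, star (a i) * a i := by gcongr
      _ = (s.card + 1) • (star (a j) * a j + ∑ i ∈ s, star (a i) * a i) := by
          rw [succ_nsmul, nsmul_add]
          abel

end StarOrderedRing

section GramForm

variable {U V ι R A : Type*} [Fintype V] [Ring A] [StarRing A]

/-- The `A`-valued quadratic form `∑ v, w, M v w • (y v)* (y w)` of a scalar matrix `M`, that is,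
the form of `M ⊗ 1` on the column `y`. -/
def gramForm [SMul R A] (M : Matrix V V R) (y : V → A) : A :=
  ∑ v, ∑ w, M v w • (star (y v) * y w)

theorem gramForm_conjTranspose_mul_self [Fintype U] [CommRing R] [StarRing R] [Algebra R A]
    [StarModule R A] (B : Matrix U V R) (y : V → A) :
    gramForm (Bᴴ * B) y = ∑ u, star (∑ v, B u v • y v) * ∑ v, B u v • y v := by
  simp only [gramForm, Matrix.mul_apply, Matrix.conjTranspose_apply, star_sum, star_smul,
    Finset.sum_mul_sum, smul_mul_smul_comm, Finset.sum_smul]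
  exact Finset.sum_comm_cycle

theorem gramForm_eq_sum_diag_smul [Semiring R] [Module R A] {M : Matrix V V R} {P : V → A}
    (hP : ∀ v, IsStarProjection (P v))
    (horth : ∀ v w, v ≠ w → M v w ≠ 0 → P v * P w = 0) :
    gramForm M P = ∑ v, M v v • P v := by
  refine Finset.sum_congr rfl fun v _ => ?_
  rw [Finset.sum_eq_single_of_mem v (Finset.mem_univ v) fun w _ hwv => ?_,
    (hP v).isSelfAdjoint.star_eq, (hP v).isIdempotentElem.eq]
  by_cases hvw : M v w = 0
  · rw [hvw, zero_smul]
  · rw [(hP v).isSelfAdjoint.star_eq, horth v w hwv.symm hvw, smul_zero]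

variable {𝕜 : Type*} [RCLike 𝕜] [Algebra 𝕜 A] [StarModule 𝕜 A] [PartialOrder A]
  [StarOrderedRing A] [Fintype ι] {M : Matrix V V 𝕜}

open scoped ComplexOrder MatrixOrder Matrix.Norms.L2Operator in
theorem gramForm_sum_le_card_nsmul (hM : M.PosSemidef) (y : ι → V → A) :
    gramForm M (∑ h, y h) ≤ Fintype.card ι • ∑ h, gramForm M (y h) := by
  classical
  obtain ⟨B, rfl⟩ := CStarAlgebra.nonneg_iff_eq_star_mul_self.1 hM.nonneg
  have hsum (u : V) : ∑ v, B u v • (∑ h, y h) v = ∑ h, ∑ v, B u v • y h v := by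
    simp only [Finset.sum_apply, Finset.smul_sum]
    exact Finset.sum_comm
  simp only [Matrix.star_eq_conjTranspose, gramForm_conjTranspose_mul_self, hsum]
  rw [Finset.sum_comm, Finset.smul_sum]
  exact Finset.sum_le_sum fun u _ => star_sum_mul_sum_le_card_nsmul _ _

open scoped ComplexOrder in
theorem sum_entries_smul_one_le_card_mul_trace_smul_one (hM : M.PosSemidef) {P : V → ι → A}
    (hproj : ∀ v h, IsStarProjection (P v h)) (hsum : ∀ v, ∑ h, P v h = 1)
    (horth : ∀ v w, v ≠ w → M v w ≠ 0 → ∀ h, P v h * P w h = 0) :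
    (∑ v, ∑ w, M v w) • (1 : A) ≤ (Fintype.card ι * M.trace) • (1 : A) :=
  calc (∑ v, ∑ w, M v w) • (1 : A) = gramForm M (∑ h, fun v => P v h) := by
        simp [gramForm, hsum, Finset.sum_smul]
    _ ≤ Fintype.card ι • ∑ h, gramForm M (fun v => P v h) := gramForm_sum_le_card_nsmul hM _
    _ = Fintype.card ι • ∑ h, ∑ v, M v v • P v h := by
        congr! 2 with h
        exact gramForm_eq_sum_diag_smul (hproj · h) fun v w hvw hMvw => horth v w hvw hMvw h
    _ = Fintype.card ι • M.trace • (1 : A) := by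
        rw [Finset.sum_comm]
        simp only [← Finset.smul_sum, hsum, Matrix.trace, Matrix.diag_apply, Finset.sum_smul]
    _ = (Fintype.card ι * M.trace) • (1 : A) := by
        rw [← Nat.cast_smul_eq_nsmul 𝕜, smul_smul]

theorem sum_entries_le_card_mul_trace [Nontrivial A] [Algebra ℝ A] [StarModule ℝ A]
    {M : Matrix V V ℝ} (hM : M.PosSemidef) {P : V → ι → A}
    (hproj : ∀ v h, IsStarProjection (P v h)) (hsum : ∀ v, ∑ h, P v h = 1)
    (horth : ∀ v w, v ≠ w → M v w ≠ 0 → ∀ h, P v h * P w h = 0) :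
    ∑ v, ∑ w, M v w ≤ Fintype.card ι * M.trace :=
  (smul_le_smul_iff_of_pos_right (zero_lt_one' A)).1 <|
    sum_entries_smul_one_le_card_mul_trace_smul_one hM hproj hsum horth

end GramForm

section QuantumColoring

variable {V : Type*} [Fintype V] {G : SimpleGraph V} {k c : ℕ} {M : Matrix V V ℝ}

open scoped ComplexOrder MatrixOrder in
theorem QuantumDistColorable.sum_entries_le_mul_trace (hcol : QuantumDistColorable G k c)
    (hM : M.PosSemidef) (hsupp : ∀ v w, (k : ℕ∞) < G.edist v w → M v w = 0) :
    ∑ v, ∑ w, M v w ≤ c * M.trace := by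
  obtain ⟨d, hd, P, hP⟩ := hcol
  have : NeZero d := ⟨hd.ne'⟩
  simpa only [Fintype.card_fin] using
    sum_entries_le_card_mul_trace hM hP.projector hP.complete fun v w hvw hMvw =>
      hP.orthogonal v w hvw <| not_lt.1 <| mt (hsupp v w) hMvw

theorem QuantumDistColorable.dotProduct_mulVec_le (hcol : QuantumDistColorable G k c)
    (hM : M.PosSemidef) (hsupp : ∀ v w, (k : ℕ∞) < G.edist v w → M v w = 0) (x : V → ℝ) :
    x ⬝ᵥ M *ᵥ x ≤ c * ∑ v, M v v * x v ^ 2 := by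
  classical
  have happly (v w : V) :
      ((Matrix.diagonal x)ᴴ * M * Matrix.diagonal x) v w = x v * M v w * x w := by
    simp
  have hle := hcol.sum_entries_le_mul_trace (hM.conjTranspose_mul_mul_same (Matrix.diagonal x))
    fun v w hvw => by rw [happly, hsupp v w hvw, mul_zero, zero_mul]
  simp only [Matrix.trace, Matrix.diag_apply, happly] at hle
  calc x ⬝ᵥ M *ᵥ x = ∑ v, ∑ w, x v * M v w * x w := by
        simp only [dotProduct, Matrix.mulVec, Finset.mul_sum, mul_assoc]
    _ ≤ c * ∑ v, x v * M v v * x v := hle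
    _ = c * ∑ v, M v v * x v ^ 2 := by
        congr! 2 with v
        ring

theorem QuantumDistColorable.le_mul_of_mem_spectrum [DecidableEq V]
    (hcol : QuantumDistColorable G k c) (hM : M.PosSemidef)
    (hsupp : ∀ v w, (k : ℕ∞) < G.edist v w → M v w = 0) {W : ℝ} (hW : ∀ v, M v v ≤ W)
    {μ : ℝ} (hμ : μ ∈ spectrum ℝ M) : μ ≤ c * W := by
  rw [hM.isHermitian.spectrum_real_eq_range_eigenvalues] at hμ
  obtain ⟨j, rfl⟩ := hμ
  let x := hM.isHermitian.eigenvectorBasis j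
  have hx : ∑ v, x v ^ 2 = 1 := by
    rw [← EuclideanSpace.real_norm_sq_eq, hM.isHermitian.eigenvectorBasis.norm_eq_one, one_pow]
  calc hM.isHermitian.eigenvalues j = x ⬝ᵥ M *ᵥ x := by
        simpa using hM.isHermitian.eigenvalues_eq j
    _ ≤ c * ∑ v, M v v * x v ^ 2 := hcol.dotProduct_mulVec_le hM hsupp _
    _ ≤ c * ∑ v, W * x v ^ 2 := by
        gcongr with v
        exact hW v
    _ = c * W := by rw [← Finset.mul_sum, hx, mul_one]

end QuantumColoring

section Polynomial

open Polynomial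

variable {V : Type*} [Fintype V] [DecidableEq V]

open scoped ComplexOrder MatrixOrder in
theorem posSemidef_aeval_of_eval_nonneg {𝕜 : Type*} [RCLike 𝕜] {A : Matrix V V 𝕜}
    (hA : A.IsHermitian) {q : ℝ[X]} (hq : ∀ μ ∈ spectrum ℝ A, 0 ≤ q.eval μ) :
    (aeval A q).PosSemidef := by
  rw [← Matrix.nonneg_iff_posSemidef, ← cfc_polynomial q A hA.isSelfAdjoint]
  exact cfc_nonneg hq

variable (G : SimpleGraph V) [DecidableRel G.Adj]

theorem adjMatrix_pow_apply_eq_zero_of_lt_edist {R : Type*} [Semiring R] {n : ℕ} {v w : V}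
    (h : (n : ℕ∞) < G.edist v w) : (G.adjMatrix R ^ n) v w = 0 := by
  have : IsEmpty {r : G.Walk v w | r.length = n} :=
    ⟨fun ⟨r, hr⟩ => h.not_ge <| r.edist_le.trans_eq <| congrArg _ hr⟩
  rw [SimpleGraph.adjMatrix_pow_apply_eq_card_walk, Fintype.card_eq_zero, Nat.cast_zero]

theorem aeval_adjMatrix_apply_eq_zero_of_lt_edist {R : Type*} [CommSemiring R] {k : ℕ} {q : R[X]}
    (hq : q.natDegree ≤ k) {v w : V} (h : (k : ℕ∞) < G.edist v w) :
    aeval (G.adjMatrix R) q v w = 0 := by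
  rw [aeval_eq_sum_range' (Nat.lt_succ_of_le hq), Matrix.sum_apply]
  refine Finset.sum_eq_zero fun i hi => ?_
  have hik : (i : ℕ∞) ≤ k := Nat.cast_le.2 <| Nat.le_of_lt_succ <| Finset.mem_range.1 hi
  rw [Matrix.smul_apply, adjMatrix_pow_apply_eq_zero_of_lt_edist G (hik.trans_lt h), smul_zero]

theorem spectrum_adjMatrix_eq_range_adjEigenvalue :
    spectrum ℝ (G.adjMatrix ℝ) = Set.range (adjEigenvalue G) := by
  rw [(G.isHermitian_adjMatrix ℝ).spectrum_real_eq_range_eigenvalues]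
  exact (Equiv.surjective _).range_comp (adjEigenvalue G)

theorem aeval_adjMatrix_apply_self_le_maxDiag (p : ℝ[X]) (v : V) :
    aeval (G.adjMatrix ℝ) p v v ≤ maxDiag G p :=
  Finite.le_ciSup (fun u => aeval (G.adjMatrix ℝ) p u u) v

theorem minEval_le_eval_adjEigenvalue (p : ℝ[X]) {i : Fin (Fintype.card V)} (hi : 1 ≤ (i : ℕ)) :
    minEval G p ≤ p.eval (adjEigenvalue G i) :=
  Finite.ciInf_le (fun j : {j : Fin (Fintype.card V) // 1 ≤ (j : ℕ)} =>
    p.eval (adjEigenvalue G j)) ⟨i, hi⟩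

variable {G}

theorem QuantumDistColorable.eval_sub_le_mul_maxDiag_sub {k c : ℕ}
    (hcol : QuantumDistColorable G k c) {p : ℝ[X]} (hdeg : p.natDegree ≤ k) {m : ℝ}
    (hm : ∀ i, m ≤ p.eval (adjEigenvalue G i)) (i : Fin (Fintype.card V)) :
    p.eval (adjEigenvalue G i) - m ≤ c * (maxDiag G p - m) := by
  have heval (μ : ℝ) : (p - C m).eval μ = p.eval μ - m := by rw [eval_sub, eval_C]
  have hspec := spectrum_adjMatrix_eq_range_adjEigenvalue G
  have hpos : (aeval (G.adjMatrix ℝ) (p - C m)).PosSemidef :=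
    posSemidef_aeval_of_eval_nonneg (G.isHermitian_adjMatrix ℝ) <| by
      simpa only [hspec, Set.forall_mem_range, heval, sub_nonneg] using hm
  have hsupp (v w : V) (h : (k : ℕ∞) < G.edist v w) :
      aeval (G.adjMatrix ℝ) (p - C m) v w = 0 :=
    aeval_adjMatrix_apply_eq_zero_of_lt_edist G (natDegree_sub_C.trans_le hdeg) h
  have hdiag (v : V) : aeval (G.adjMatrix ℝ) (p - C m) v v ≤ maxDiag G p - m := by
    simpa [Matrix.algebraMap_matrix_apply] using aeval_adjMatrix_apply_self_le_maxDiag G p v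
  have hmem : p.eval (adjEigenvalue G i) - m ∈ spectrum ℝ (aeval (G.adjMatrix ℝ) (p - C m)) :=
    spectrum.subset_polynomial_aeval _ _
      ⟨adjEigenvalue G i, hspec ▸ Set.mem_range_self i, heval _⟩
  exact hcol.le_mul_of_mem_spectrum hpos hsupp hdiag hmem

end Polynomial

theorem quantumDistColorable_quantumDistChromaticNumber {V : Type*} [Fintype V]
    (G : SimpleGraph V) (k : ℕ) : QuantumDistColorable G k (quantumDistChromaticNumber G k) :=
  Nat.sInf_mem (s := {c | QuantumDistColorable G k c}) ⟨_, quantumDistColorable_card G k⟩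

theorem mainTheorem4_general {V : Type*} [Fintype V] [DecidableEq V] (G : SimpleGraph V)
    [DecidableRel G.Adj] (k : ℕ) (p : Polynomial ℝ) (hdeg : p.natDegree ≤ k) {m : ℝ}
    {i : Fin (Fintype.card V)} (hm : ∀ j, j ≠ i → m ≤ p.eval (adjEigenvalue G j))
    (hi : m < p.eval (adjEigenvalue G i)) :
    (p.eval (adjEigenvalue G i) - m) / (maxDiag G p - m) ≤
      (quantumDistChromaticNumber G k : ℝ) := by
  have hmin (j : Fin (Fintype.card V)) : m ≤ p.eval (adjEigenvalue G j) := by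
    obtain rfl | hj := eq_or_ne j i
    exacts [hi.le, hm j hj]
  have hle := (quantumDistColorable_quantumDistChromaticNumber G k).eval_sub_le_mul_maxDiag_sub
    hdeg hmin i
  have hden : 0 < maxDiag G p - m :=
    pos_of_mul_pos_right ((sub_pos.2 hi).trans_le hle) (Nat.cast_nonneg _)
  exact (div_le_iff₀ hden).2 hle

theorem mainTheorem4 {V : Type*} [Fintype V] [DecidableEq V] (G : SimpleGraph V)
    [DecidableRel G.Adj] (hn : 2 ≤ Fintype.card V) (k : ℕ) (p : Polynomial ℝ)
    (hdeg : p.natDegree ≤ k)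
    (hp : ∀ i : Fin (Fintype.card V), 1 ≤ (i : ℕ) →
      p.eval (adjEigenvalue G i) < p.eval (adjEigenvalue G ⟨0, by omega⟩)) :
    (p.eval (adjEigenvalue G ⟨0, by omega⟩) - minEval G p) / (maxDiag G p - minEval G p) ≤
      (quantumDistChromaticNumber G k : ℝ) := by
  exact mainTheorem4_general G k p hdeg
    (fun j hj => minEval_le_eval_adjEigenvalue G p <| Nat.pos_of_ne_zero <| Fin.val_ne_of_ne hj)
    ((minEval_le_eval_adjEigenvalue G p (i := ⟨1, hn⟩) le_rfl).trans_lt (hp _ le_rfl))
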